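/- Let $p\ge 2$ be an integer. Write $\mathbb T=\mathbb R/\mathbb Z$ and, for $m\in\mathbb Z$, $T_m:\mathbb T\to\mathbb T$, $x\mapsto mx \bmod 1$. Let $\mathcal P_p(\mathbb T)$ be the space of $T_p$-invariant Borel probability measures on $\mathbb T$, with the weak-star topology, and let $\mathrm{Leb}$ be the normalised Lebesgue measure. For an integer $m\ge 0$ let $$\psi(m)=R_0(m)+R_{p-1}(m)+N(m),$$ where, in the base-$p$ expansion of $m$, $R_0(m)$ is the number of maximal blocks of $0$s, $R_{p-1}(m)$ is the number of maximal blocks of $(p-1)$s, and $N(m)$ is the number of digits other than $0$ and $p-1$ (with $\psi(0)=0$); for $m<0$ put $\psi(m)=\psi(|m|)$. Let $(c_n)_{n\ge 0}$ be a sequence of integers such that for every $a\in\mathbb Z\setminus\{0\}$ the sequence $(\psi(ac_n))_{n\ge 0}$ tends to infinity along a set of density $1$, i.e. for every $K$ the set $\{n\ge1:\psi(ac_n)\ge K\}$ has natural density $1$. Then the set of all measures $\mu\in\mathcal P_p(\mathbb T)$ which are continuous (have no atoms) and satisfy $T_{c_n}\mu\to\mathrm{Leb}$ weak-star along a set of upper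 density $1$, i.e. for every weak-star neighbourhood $V$ of $\mathrm{Leb}$ in the space of Borel probability measures on $\mathbb T$, $$\limsup_{N\to\infty}\frac1N\,\#\{1\le n\le N: T_{c_n}\mu\in V\}=1,$$ is residual in $\mathcal P_p(\mathbb T)$, i.e. contains a countable intersection of dense open subsets of $\mathcal P_p(\mathbb T)$. -/

import Mathlib

open MeasureTheory Filter Topology

noncomputable section

namespace TimesP

/-- The map `T_m : x ↦ m x mod 1` of the circle `ℝ / ℤ`. -/
def timesMap (m : ℤ) (x : UnitAddCircle) : UnitAddCircle := m • x

theorem measurable_timesMap (m : ℤ) : Measurable (timesMap m) :=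
  (continuous_zsmul m).measurable

/-- The image measure `T_m μ`. -/
def push (m : ℤ) (μ : ProbabilityMeasure UnitAddCircle) : ProbabilityMeasure UnitAddCircle :=
  μ.map (measurable_timesMap m).aemeasurable

/-- The normalised Lebesgue measure on the circle. -/
def leb : ProbabilityMeasure UnitAddCircle :=
  ⟨volume, ⟨UnitAddCircle.measure_univ⟩⟩

/-- The space of `T_p`-invariant Borel probability measures on the circle. As a subtype of
`ProbabilityMeasure UnitAddCircle` it carries the topology of weak-star convergence. -/
abbrev InvMeasure (p : ℕ) : Type :=
  {μ : ProbabilityMeasure UnitAddCircle // push (p : ℤ) μ = μ}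

/-- The proportion of elements of `A` among `1, …, N`. -/
def proportion (A : Set ℕ) (N : ℕ) : ℝ :=
  ((A ∩ Set.Icc 1 N).ncard : ℝ) / N

/-- `A` has natural density `1`. -/
def HasDensityOne (A : Set ℕ) : Prop :=
  Tendsto (proportion A) atTop (𝓝 1)

/-- `A` has upper density `1`. -/
def HasUpperDensityOne (A : Set ℕ) : Prop :=
  limsup (proportion A) atTop = 1

/-- `ν n → ν₀` along a set of upper density `1`: every neighbourhood `V` of `ν₀` contains `ν n`
for all `n` in a set of upper density `1`. -/
def TendstoAlongUpperDensityOne {X : Type*} [TopologicalSpace X] (ν : ℕ → X) (ν₀ : X) : Prop :=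
  ∀ V ∈ 𝓝 ν₀, HasUpperDensityOne {n : ℕ | ν n ∈ V}

/-- `u n → +∞` along a set of density `1`: for every `K`, `u n ≥ K` for all `n` in a set of
density `1`. -/
def TendstoInftyAlongDensityOne (u : ℕ → ℕ) : Prop :=
  ∀ K : ℕ, HasDensityOne {n : ℕ | K ≤ u n}

/-- The number of maximal blocks of the letter `d` in the word `w`. A block is counted through its
last position. -/
def numBlocks (d : ℕ) (w : List ℕ) : ℕ :=
  ((Finset.range w.length).filter fun i => w[i]? = some d ∧ w[i + 1]? ≠ some d).card

/-- The base-`p` digit complexity: the number of maximal blocks of `0`s, plus the number of maximal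
blocks of `(p - 1)`s, plus the number of other digits. -/
def digitComplexity (p m : ℕ) : ℕ :=
  numBlocks 0 (p.digits m) + numBlocks (p - 1) (p.digits m) +
    (p.digits m).countP fun x => x ≠ 0 ∧ x ≠ p - 1

/-- The set of continuous `T_p`-invariant probability measures `μ` such that `T_{c n} μ → Leb`
along a set of upper density `1`. -/
def goodMeasures (p : ℕ) (c : ℕ → ℤ) : Set (InvMeasure p) :=
  {μ | (∀ x : UnitAddCircle, (μ.1 : Measure UnitAddCircle) {x} = 0) ∧
    TendstoAlongUpperDensityOne (fun n => push (c n) μ.1) leb}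

end TimesP

end

/-!
The measures `μ` with `T_{c n} μ → Leb` along a set of upper density `1` form a `Gδ` set, because
`μ ↦ T_{c n} μ` is continuous, and none of them has atoms, because `T_m` does not decrease the mass
of the largest atom. So it remains to see that they are dense.

To approximate an invariant `μ`, take the law under `μ` of the block of the first `L` base-`p`
digits, give a little extra mass to the blocks `0` and `1`, let the base-`p ^ L` digits be
independent with this law, and average over `T_1, T_p, …, T_{p ^ (L - 1)}` to get invariance under
`T_p`. Since digit independence turns the Fourier coefficient at `m` into an infinite product of
values at `m / p ^ (L k)` of the transform of one digit, and the mass at `0` and `1` makes the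
factor at `x` at most `exp (-κ ‖x‖²)`, where `‖x‖` is the distance to the integers, the coefficient
is at most `exp (-κ ∑ ‖m / p ^ (L k)‖²)`. The number `m / p ^ (i + 2)` is far from the integers
whenever the digits of `m` at the positions `i` and `i + 1` are not both `0` and not both `p - 1`,
and such positions number at least `ψ(m) / 3`. So the coefficient at `m` decays exponentially in
`ψ(m)`, and `T_{c n}` of the approximating measure tends to `Leb` along a set of density `1`.
-/

noncomputable section

namespace TimesP

section Density

theorem ncard_inter_Icc_one_le (A : Set ℕ) (N : ℕ) : (A ∩ Set.Icc 1 N).ncard ≤ N := by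
  simpa using Set.ncard_le_ncard Set.inter_subset_right (Set.finite_Icc 1 N)

theorem proportion_nonneg (A : Set ℕ) (N : ℕ) : 0 ≤ proportion A N := by
  unfold proportion
  positivity

theorem proportion_le_one (A : Set ℕ) (N : ℕ) : proportion A N ≤ 1 :=
  div_le_one_of_le₀ (mod_cast ncard_inter_Icc_one_le A N) N.cast_nonneg

theorem proportion_le_proportion {A B : Set ℕ} {N : ℕ} (h : A ∩ Set.Icc 1 N ⊆ B) :
    proportion A N ≤ proportion B N := by
  have : (A ∩ Set.Icc 1 N).ncard ≤ (B ∩ Set.Icc 1 N).ncard :=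
    Set.ncard_le_ncard (Set.subset_inter h Set.inter_subset_right)
      ((Set.finite_Icc 1 N).inter_of_right B)
  unfold proportion
  gcongr

theorem proportion_add_proportion_le (A B : Set ℕ) (N : ℕ) :
    proportion A N + proportion B N ≤ 1 + proportion (A ∩ B) N := by
  have hfin (C : Set ℕ) : (C ∩ Set.Icc 1 N).Finite := (Set.finite_Icc 1 N).inter_of_right C
  have hcard : (A ∩ Set.Icc 1 N).ncard + (B ∩ Set.Icc 1 N).ncard ≤
      N + (A ∩ B ∩ Set.Icc 1 N).ncard := by
    rw [← Set.ncard_union_add_ncard_inter _ _ (hfin A) (hfin B), ← Set.union_inter_distrib_right,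
      ← Set.inter_inter_distrib_right]
    exact Nat.add_le_add_right (ncard_inter_Icc_one_le _ N) _
  rcases N.eq_zero_or_pos with rfl | hN
  · simp [proportion]
  · have hN' : (0 : ℝ) < N := mod_cast hN
    unfold proportion
    rw [← add_div, one_add_div hN'.ne']
    exact div_le_div_of_nonneg_right (mod_cast hcard) hN'.le

theorem HasDensityOne.mono {A B : Set ℕ} (hA : HasDensityOne A) (h : A ⊆ B) : HasDensityOne B :=
  tendsto_of_tendsto_of_tendsto_of_le_of_le hA tendsto_const_nhds
    (fun _ => proportion_le_proportion (Set.inter_subset_left.trans h)) (proportion_le_one B)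

theorem HasDensityOne.inter {A B : Set ℕ} (hA : HasDensityOne A) (hB : HasDensityOne B) :
    HasDensityOne (A ∩ B) := by
  have hlower : Tendsto (fun N => proportion A N + proportion B N - 1) atTop (𝓝 1) := by
    simpa using (Tendsto.add hA hB).sub_const 1
  exact tendsto_of_tendsto_of_tendsto_of_le_of_le hlower tendsto_const_nhds
    (fun N => sub_le_iff_le_add'.2 (proportion_add_proportion_le A B N)) (proportion_le_one _)

theorem hasDensityOne_univ : HasDensityOne Set.univ := by
  refine tendsto_const_nhds.congr' ?_
  filter_upwards [eventually_ne_atTop 0] with N hN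
  simp [proportion, hN]

/-- The filter of sets of natural density `1`, so that convergence along a set of density `1` is
convergence along a filter. -/
def densityOne : Filter ℕ where
  sets := {A | HasDensityOne A}
  univ_sets := hasDensityOne_univ
  sets_of_superset := HasDensityOne.mono
  inter_sets := HasDensityOne.inter

theorem TendstoInftyAlongDensityOne.tendsto {u : ℕ → ℕ} (hu : TendstoInftyAlongDensityOne u) :
    Tendsto u densityOne atTop :=
  tendsto_atTop.2 hu

theorem hasUpperDensityOne_iff {A : Set ℕ} :
    HasUpperDensityOne A ↔ ∀ b < 1, ∃ᶠ N in atTop, b < proportion A N := by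
  have hle : IsBoundedUnder (· ≤ ·) atTop (proportion A) :=
    isBoundedUnder_of ⟨1, proportion_le_one A⟩
  have hge : IsCoboundedUnder (· ≤ ·) atTop (proportion A) :=
    (isBoundedUnder_of (r := (· ≥ ·)) ⟨0, proportion_nonneg A⟩).isCoboundedUnder_le
  have hlimsup : limsup (proportion A) atTop ≤ 1 :=
    limsup_le_of_le hge (Eventually.of_forall (proportion_le_one A))
  rw [← le_limsup_iff hge hle, HasUpperDensityOne]
  exact ⟨ge_of_eq, hlimsup.antisymm⟩

theorem HasDensityOne.hasUpperDensityOne {A : Set ℕ} (hA : HasDensityOne A) :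
    HasUpperDensityOne A :=
  Tendsto.limsup_eq hA

theorem HasUpperDensityOne.mono {A B : Set ℕ} (hA : HasUpperDensityOne A) (h : A ⊆ B) :
    HasUpperDensityOne B :=
  hasUpperDensityOne_iff.2 fun b hb => (hasUpperDensityOne_iff.1 hA b hb).mono fun _ hN =>
    hN.trans_le (proportion_le_proportion (Set.inter_subset_left.trans h))

theorem HasUpperDensityOne.nonempty {A : Set ℕ} (hA : HasUpperDensityOne A) : A.Nonempty := by
  obtain ⟨N, hN⟩ := (hasUpperDensityOne_iff.1 hA 0 one_pos).exists
  by_contra hempty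
  simp [Set.not_nonempty_iff_eq_empty.1 hempty, proportion] at hN

end Density

section UpperDensityGδ

variable {X Y : Type*} [TopologicalSpace X] [TopologicalSpace Y]

theorem tendstoAlongUpperDensityOne_of_tendsto {ν : ℕ → Y} {y : Y}
    (h : Tendsto ν densityOne (𝓝 y)) : TendstoAlongUpperDensityOne ν y :=
  fun _ hV => HasDensityOne.hasUpperDensityOne (h hV)

theorem isOpen_setOf_lt_proportion {f : ℕ → X → Y} (hf : ∀ n, Continuous (f n)) {U : Set Y}
    (hU : IsOpen U) (b : ℝ) (N : ℕ) : IsOpen {x | b < proportion {n | f n x ∈ U} N} := by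
  refine isOpen_iff_mem_nhds.2 fun x hx => ?_
  have hnear : ∀ᶠ z in 𝓝 x, ∀ n ∈ Set.Icc 1 N, f n x ∈ U → f n z ∈ U :=
    (Set.finite_Icc 1 N).eventually_all.2 fun n _ => eventually_imp_distrib_left.2
      fun hn => (hf n).continuousAt (hU.mem_nhds hn)
  filter_upwards [hnear] with z hz
  exact lt_of_lt_of_le hx (proportion_le_proportion fun n hn => hz n hn.2 hn.1)

theorem isGδ_setOf_tendstoAlongUpperDensityOne {f : ℕ → X → Y} (hf : ∀ n, Continuous (f n)) (y : Y)
    [(𝓝 y).IsCountablyGenerated] :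
    IsGδ {x | TendstoAlongUpperDensityOne (fun n => f n x) y} := by
  obtain ⟨U, hU, hbasis⟩ := (nhds_basis_opens y).exists_antitone_subbasis
  have hset : {x | TendstoAlongUpperDensityOne (fun n => f n x) y} =
      ⋂ (j : ℕ) (k : ℕ) (N₀ : ℕ), ⋃ (N) (_ : N₀ ≤ N),
        {x | 1 - 1 / ((k : ℝ) + 1) < proportion {n | f n x ∈ U j} N} := by
    ext x
    simp only [Set.mem_iInter, Set.mem_iUnion, Set.mem_ofPred_eq, exists_prop]
    refine ⟨fun h j k => frequently_atTop.1 (hasUpperDensityOne_iff.1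
      (h _ (hbasis.toHasBasis.mem_of_mem trivial)) _ (sub_lt_self _ (by positivity))),
      fun h V hV => ?_⟩
    obtain ⟨j, -, hj⟩ := hbasis.toHasBasis.mem_iff.1 hV
    refine HasUpperDensityOne.mono (A := {n | f n x ∈ U j})
      (hasUpperDensityOne_iff.2 fun b hb => ?_) fun n hn => hj hn
    obtain ⟨k, hk⟩ := exists_nat_one_div_lt (sub_pos.2 hb)
    exact (frequently_atTop.2 (h j k)).mono fun N hN => by linarith
  rw [hset]
  exact .iInter fun j => .iInter fun k => .iInter fun N₀ =>
    (isOpen_biUnion fun N _ => isOpen_setOf_lt_proportion hf (hU j).2 _ N).isGδ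

end UpperDensityGδ

section FourierStieltjes

/-- The Fourier–Stieltjes coefficient `∫ exp (2 π i m x) dμ(x)`; the sign in the exponent is that of
`charFun`. -/
def fourierStieltjes (μ : Measure UnitAddCircle) (m : ℤ) : ℂ := ∫ x, fourier m x ∂μ

theorem fourierStieltjes_zero (μ : Measure UnitAddCircle) [IsProbabilityMeasure μ] :
    fourierStieltjes μ 0 = 1 := by
  simp [fourierStieltjes]

theorem fourierStieltjes_leb {m : ℤ} (hm : m ≠ 0) : fourierStieltjes leb m = 0 :=
  integral_eq_zero_of_add_right_eq_neg (μ := (volume : Measure UnitAddCircle))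
    (fourier_add_half_inv_index (T := 1) hm one_pos)

theorem fourierStieltjes_map_timesMap (μ : Measure UnitAddCircle) (c m : ℤ) :
    fourierStieltjes (μ.map (timesMap c)) m = fourierStieltjes μ (m * c) := by
  rw [fourierStieltjes, integral_map (measurable_timesMap c).aemeasurable
    (fourier m).continuous.aestronglyMeasurable]
  simp [fourierStieltjes, timesMap, fourier_apply, mul_smul]

theorem fourierStieltjes_push (c : ℤ) (μ : ProbabilityMeasure UnitAddCircle) (m : ℤ) :
    fourierStieltjes (push c μ) m = fourierStieltjes μ (m * c) := by
  rw [push, ProbabilityMeasure.toMeasure_map, fourierStieltjes_map_timesMap]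

theorem fourierStieltjes_smul (r : ENNReal) (μ : Measure UnitAddCircle) (m : ℤ) :
    fourierStieltjes (r • μ) m = r.toReal • fourierStieltjes μ m :=
  integral_smul_measure _ r

theorem measure_eq_of_fourierStieltjes_eq {μ ν : Measure UnitAddCircle} [IsFiniteMeasure μ]
    [IsFiniteMeasure ν] (h : fourierStieltjes μ = fourierStieltjes ν) : μ = ν := by
  have hint (κ : Measure UnitAddCircle) [IsFiniteMeasure κ] (f : C(UnitAddCircle, ℂ)) :
      Integrable f κ :=
    f.continuous.integrable_of_hasCompactSupport (.of_compactSpace f)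
  have hspan (f : C(UnitAddCircle, ℂ)) (hf : f ∈ Submodule.span ℂ (Set.range fourier)) :
      ∫ x, f x ∂μ = ∫ x, f x ∂ν := by
    induction hf using Submodule.span_induction with
    | mem _ hf =>
      obtain ⟨m, rfl⟩ := hf
      exact congrFun h m
    | zero => simp
    | add f g _ _ hf hg =>
      simp only [ContinuousMap.add_apply, integral_add (hint _ f) (hint _ g), hf, hg]
    | smul a f _ hf => simp only [ContinuousMap.smul_apply, integral_smul, hf]
  refine ext_of_forall_mem_subalgebra_integral_eq_of_polish (𝕜 := ℂ)
    (A := fourierSubalgebra.comap (BoundedContinuousFunction.toContinuousMapStarₐ ℂ)) ?_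
    fun f hf => hspan f.toContinuousMap ?_
  · exact Set.separatesPoints_mono
      (Set.image_mono fun g hg => ⟨.mkOfCompact g, hg, rfl⟩) fourierSubalgebra_separatesPoints
  · rw [← fourierSubalgebra_coe]
    exact hf

/-- Weak convergence of measures on the circle is convergence of every coefficient: the measures
form a compact space, on which the coefficients are continuous and separate points. -/
theorem tendsto_iff_forall_fourierStieltjes {ι : Type*} {l : Filter ι}
    {μs : ι → ProbabilityMeasure UnitAddCircle} {μ : ProbabilityMeasure UnitAddCircle} :
    Tendsto μs l (𝓝 μ) ↔
      ∀ m, Tendsto (fun i => fourierStieltjes (μs i) m) l (𝓝 (fourierStieltjes μ m)) := by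
  have hcont : Continuous fun ν : ProbabilityMeasure UnitAddCircle => fourierStieltjes ν :=
    continuous_pi fun m => continuous_iff_continuousAt.2 fun ν =>
      (ProbabilityMeasure.tendsto_iff_forall_integral_rclike_tendsto ℂ).1 tendsto_id
        (.mkOfCompact (fourier m))
  have hinj : Function.Injective fun ν : ProbabilityMeasure UnitAddCircle => fourierStieltjes ν :=
    fun ν κ h => Subtype.ext (measure_eq_of_fourierStieltjes_eq (μ := (ν : Measure _))
      (ν := (κ : Measure _)) h)
  rw [(hcont.isClosedEmbedding hinj).tendsto_nhds_iff, tendsto_pi_nhds]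
  rfl

end FourierStieltjes

section Atoms

variable {X : Type*} [TopologicalSpace X] [MeasurableSpace X]

theorem eventually_forall_singleton_lt [CompactSpace X] [RegularSpace X] [HasOuterApproxClosed X]
    [OpensMeasurableSpace X] (μ : ProbabilityMeasure X) [(μ : Measure X).OuterRegular]
    [NullSingletonClass (μ : Measure X)] {a : ENNReal} (ha : 0 < a) :
    ∀ᶠ ν : ProbabilityMeasure X in 𝓝 μ, ∀ x, (ν : Measure X) {x} < a := by
  have hnhds (x : X) : ∃ F ∈ 𝓝 x, IsClosed F ∧ (μ : Measure X) F < a := by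
    obtain ⟨U, hxU, hU, hμU⟩ := Set.exists_isOpen_lt_of_lt (μ := (μ : Measure X)) {x} a (by simpa)
    obtain ⟨F, hF, hFclosed, hFU⟩ :=
      exists_mem_nhds_isClosed_subset (hU.mem_nhds (hxU (Set.mem_singleton x)))
    exact ⟨F, hF, hFclosed, (measure_mono hFU).trans_lt hμU⟩
  choose F hF hFclosed hFa using hnhds
  obtain ⟨t, ht⟩ := CompactSpace.elim_nhds_subcover F hF
  have hnear : ∀ᶠ ν : ProbabilityMeasure X in 𝓝 μ, ∀ y ∈ t, (ν : Measure X) (F y) < a :=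
    (Filter.eventually_all_finset t).2 fun y _ => eventually_lt_of_limsup_lt <|
      (ProbabilityMeasure.limsup_measure_closed_le_of_tendsto tendsto_id (hFclosed y)).trans_lt
        (hFa y)
  filter_upwards [hnear] with ν hν x
  obtain ⟨y, hy, hxy⟩ := Set.mem_iUnion₂.1 (ht.ge (Set.mem_univ x))
  exact (measure_mono (Set.singleton_subset_iff.2 hxy)).trans_lt (hν y hy)

end Atoms

theorem singleton_le_push (c : ℤ) (μ : ProbabilityMeasure UnitAddCircle) (x : UnitAddCircle) :
    (μ : Measure UnitAddCircle) {x} ≤ (push c μ : Measure UnitAddCircle) {timesMap c x} := by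
  rw [push, ProbabilityMeasure.toMeasure_map,
    Measure.map_apply (measurable_timesMap c) (measurableSet_singleton _)]
  exact measure_mono (by simp)

instance : NullSingletonClass (leb : Measure UnitAddCircle) where
  measure_singleton x := by
    have h := AddCircle.volume_closedBall (T := 1) (x := x) 0
    rwa [Metric.closedBall_zero, mul_zero, min_eq_right zero_le_one, ENNReal.ofReal_zero] at h

theorem singleton_eq_zero_of_tendstoAlongUpperDensityOne {c : ℕ → ℤ}
    {μ : ProbabilityMeasure UnitAddCircle}
    (h : TendstoAlongUpperDensityOne (fun n => push (c n) μ) leb) (x : UnitAddCircle) :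
    (μ : Measure UnitAddCircle) {x} = 0 := by
  by_contra hx
  obtain ⟨n, hn⟩ := HasUpperDensityOne.nonempty
    (h _ (eventually_forall_singleton_lt leb (pos_iff_ne_zero.2 hx)))
  exact (singleton_le_push (c n) μ x).not_gt (hn _)

section OrbitAverage

variable {X : Type*} [MeasurableSpace X] {T : X → X}

/-- The average of `μ` along its first `n` iterates under `T`. -/
def orbitAverage (T : X → X) (n : ℕ) (μ : Measure X) : Measure X :=
  (n : ENNReal)⁻¹ • ∑ i ∈ Finset.range n, μ.map T^[i]

theorem isProbabilityMeasure_orbitAverage (hT : Measurable T) {n : ℕ} (hn : n ≠ 0) (μ : Measure X)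
    [IsProbabilityMeasure μ] : IsProbabilityMeasure (orbitAverage T n μ) where
  measure_univ := by
    simp [orbitAverage, Measure.finsetSum_apply, Measure.map_apply (hT.iterate _),
      ENNReal.inv_mul_cancel, hn]

theorem measurePreserving_orbitAverage (hT : Measurable T) {n : ℕ} {μ : Measure X}
    (h : MeasurePreserving T^[n] μ μ) :
    MeasurePreserving T (orbitAverage T n μ) (orbitAverage T n μ) := by
  have hmap (i : ℕ) : (μ.map T^[i]).map T = μ.map T^[i + 1] := by
    rw [Measure.map_map hT (hT.iterate i), Function.iterate_succ']
  refine ⟨hT, ?_⟩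
  rw [orbitAverage, Measure.map_smul, Measure.map_finset_sum hT.aemeasurable]
  simp_rw [hmap]
  cases n with
  | zero => simp
  | succ k =>
    rw [Finset.sum_range_succ, Finset.sum_range_succ' (fun i => μ.map T^[i]), h.map_eq,
      Function.iterate_zero, Measure.map_id]

theorem iterate_timesMap (p n : ℕ) : (timesMap p)^[n] = timesMap (p ^ n : ℕ) := by
  ext x
  rw [timesMap, Nat.cast_pow]
  exact congrFun (smul_iterate (p : ℤ) n) x

theorem fourierStieltjes_orbitAverage (p n : ℕ) (μ : Measure UnitAddCircle) [IsFiniteMeasure μ]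
    (m : ℤ) : fourierStieltjes (orbitAverage (timesMap p) n μ) m =
      (n : ℝ)⁻¹ • ∑ i ∈ Finset.range n, fourierStieltjes μ (m * p ^ i) := by
  have hint (i : ℕ) : Integrable (fourier m) (μ.map (timesMap (p ^ i : ℕ))) :=
    (fourier m).continuous.integrable_of_hasCompactSupport (.of_compactSpace _)
  simp_rw [orbitAverage, fourierStieltjes_smul, iterate_timesMap]
  rw [fourierStieltjes, integral_finsetSum_measure fun i _ => hint i]
  congr 1
  · simp
  · refine Finset.sum_congr rfl fun i _ => ?_
    rw [← Nat.cast_pow]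
    exact fourierStieltjes_map_timesMap μ _ m

theorem fourierStieltjes_mul_pow {p : ℕ} {μ : ProbabilityMeasure UnitAddCircle}
    (hμ : push (p : ℤ) μ = μ) (m : ℤ) (i : ℕ) :
    fourierStieltjes μ (m * p ^ i) = fourierStieltjes μ m := by
  induction i with
  | zero => simp
  | succ i ih => rw [pow_succ, ← mul_assoc, ← fourierStieltjes_push, hμ, ih]

end OrbitAverage

section CharFun

variable {Ω : Type*} [MeasurableSpace Ω] {P : Measure Ω}

theorem norm_charFun_map_sub_le [IsProbabilityMeasure P] {X Y : Ω → ℝ} (hX : Measurable X)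
    (hY : Measurable Y) {δ : ℝ} (h : ∀ ω, |X ω - Y ω| ≤ δ) (t : ℝ) :
    ‖charFun (P.map X) t - charFun (P.map Y) t‖ ≤ |t| * δ := by
  have hexp (Z : Ω → ℝ) (hZ : Measurable Z) : charFun (P.map Z) t =
      ∫ ω, Complex.exp (t * Z ω * Complex.I) ∂P := by
    rw [charFun_apply_real, integral_map hZ.aemeasurable (by fun_prop)]
  have hint (Z : Ω → ℝ) (hZ : Measurable Z) :
      Integrable (fun ω => Complex.exp (t * Z ω * Complex.I)) P :=
    .of_bound (by fun_prop) 1 (ae_of_all _ fun ω => by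
      rw [← Complex.ofReal_mul, Complex.norm_exp_ofReal_mul_I])
  rw [hexp X hX, hexp Y hY, ← integral_sub (hint X hX) (hint Y hY)]
  refine (norm_integral_le_of_norm_le_const (C := |t| * δ) (ae_of_all _ fun ω => ?_)).trans_eq
    (by simp)
  have hfactor : Complex.exp (t * X ω * Complex.I) - Complex.exp (t * Y ω * Complex.I) =
      Complex.exp ((t * Y ω : ℝ) * Complex.I) *
        (Complex.exp (Complex.I * (t * (X ω - Y ω) : ℝ)) - 1) := by
    rw [mul_sub, ← Complex.exp_add, mul_one]
    push_cast
    ring_nf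
  rw [hfactor, norm_mul, Complex.norm_exp_ofReal_mul_I, one_mul]
  refine Real.norm_exp_I_mul_ofReal_sub_one_le.trans ?_
  rw [Real.norm_eq_abs, abs_mul]
  exact mul_le_mul_of_nonneg_left (h ω) (abs_nonneg t)

theorem fourierStieltjes_map_coe (κ : Measure ℝ) (m : ℤ) :
    fourierStieltjes (κ.map (↑)) m = charFun κ (2 * Real.pi * m) := by
  rw [fourierStieltjes, integral_map AddCircle.measurable_mk'.aemeasurable
    (fourier m).continuous.aestronglyMeasurable, charFun_apply_real]
  refine integral_congr_ae (ae_of_all _ fun x => ?_)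
  simp only [fourier_coe_apply]
  congr 1
  push_cast
  ring

theorem norm_one_add_exp (θ : ℝ) :
    ‖1 + Complex.exp (2 * θ * Complex.I)‖ = 2 * |Real.cos θ| := by
  have hfactor : 1 + Complex.exp (2 * θ * Complex.I) =
      (2 * Real.cos θ : ℝ) * Complex.exp (θ * Complex.I) := by
    push_cast
    rw [Complex.two_cos, add_mul, ← Complex.exp_add, ← Complex.exp_add, neg_mul, neg_add_cancel,
      Complex.exp_zero, add_comm, ← two_mul, mul_assoc]
  rw [hfactor, norm_mul, Complex.norm_exp_ofReal_mul_I, mul_one, Complex.norm_real,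
    Real.norm_eq_abs, abs_mul, abs_two]

theorem abs_cos_mul_pi_le (x : ℝ) :
    |Real.cos (x * Real.pi)| ≤ 1 - 2 * ‖(x : UnitAddCircle)‖ ^ 2 := by
  rw [UnitAddCircle.norm_eq]
  set y := x - round x with hy
  have hcos : |Real.cos (x * Real.pi)| = |Real.cos (|y| * Real.pi)| := by
    rw [← Real.cos_abs (|y| * _), abs_mul, abs_abs, ← abs_mul, Real.cos_abs, hy, sub_mul,
      Real.cos_sub_int_mul_pi, abs_mul, abs_neg_one_zpow, one_mul]
  have hy_half : |y| ≤ 1 / 2 := abs_sub_round x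
  have hangle : |y| * Real.pi ≤ Real.pi / 2 := by nlinarith [Real.pi_pos]
  have hangle_nonneg : 0 ≤ |y| * Real.pi := by positivity
  rw [hcos, abs_of_nonneg (Real.cos_nonneg_of_neg_pi_div_two_le_of_le (by linarith) hangle)]
  refine (Real.cos_le_one_sub_mul_cos_sq ?_).trans_eq ?_
  · rw [abs_of_nonneg hangle_nonneg]
    linarith
  · field

end CharFun

section DigitEnergy

/-- The sum of the squared distances to the integers of `x / b, x / b ^ 2, …, x / b ^ K`: the
quantity that relates Fourier decay of laws with independent digits to the digit complexity. -/
def digitEnergy (b : ℕ) (x : ℝ) (K : ℕ) : ℝ :=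
  ∑ k ∈ Finset.range K, ‖((x / b ^ (k + 1) : ℝ) : UnitAddCircle)‖ ^ 2

theorem digitEnergy_mono (b : ℕ) (x : ℝ) : Monotone (digitEnergy b x) := fun _ _ h =>
  Finset.sum_le_sum_of_subset_of_nonneg (Finset.range_mono h) fun _ _ _ => sq_nonneg _

theorem digitEnergy_neg (b : ℕ) (x : ℝ) (K : ℕ) : digitEnergy b (-x) K = digitEnergy b x K := by
  simp_rw [digitEnergy, neg_div, AddCircle.coe_neg, norm_neg]

theorem digitEnergy_abs (b : ℕ) (x : ℝ) (K : ℕ) : digitEnergy b |x| K = digitEnergy b x K := by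
  rcases abs_choice x with h | h <;> simp only [h, digitEnergy_neg]

variable {p : ℕ}

theorem digitEnergy_le_digitEnergy_mul_pow (hp : p ≠ 0) (x : ℝ) (a J : ℕ) :
    digitEnergy p x J ≤ digitEnergy p (x * p ^ a) (a + J) := by
  have hp0 : (p : ℝ) ≠ 0 := Nat.cast_ne_zero.2 hp
  have hshift (j : ℕ) : x * p ^ a / p ^ (a + j + 1) = x / p ^ (j + 1) := by
    rw [add_assoc, pow_add, mul_comm ((p : ℝ) ^ a), mul_div_mul_right _ _ (pow_ne_zero a hp0)]
  simp only [digitEnergy, Finset.sum_range_add, hshift]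
  exact le_add_of_nonneg_left (Finset.sum_nonneg fun _ _ => sq_nonneg _)

theorem norm_coe_mul_pow_le (hp : p ≠ 0) (x : ℝ) {r L : ℕ} (hr : r ≤ L) :
    ‖((x * p ^ r : ℝ) : UnitAddCircle)‖ ≤ (p ^ L : ℕ) * ‖(x : UnitAddCircle)‖ := by
  have hsmul : ((x * p ^ r : ℝ) : UnitAddCircle) = (p ^ r : ℕ) • (x : UnitAddCircle) := by
    rw [← AddCircle.coe_nsmul, nsmul_eq_mul, Nat.cast_pow, mul_comm]
  rw [hsmul]
  refine norm_nsmul_le.trans ?_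
  gcongr
  exact Nat.pos_of_ne_zero hp

theorem digitEnergy_mul_le (hp : p ≠ 0) (x : ℝ) (L K : ℕ) :
    digitEnergy p x (L * K) ≤ L * (p ^ L : ℕ) ^ 2 * digitEnergy (p ^ L) x K := by
  have hterm (k r : ℕ) (hr : r ∈ Finset.range L) :
      ‖((x / p ^ (L * k + r + 1) : ℝ) : UnitAddCircle)‖ ^ 2 ≤
        (p ^ L : ℕ) ^ 2 * ‖((x / (p ^ L : ℕ) ^ (k + 1) : ℝ) : UnitAddCircle)‖ ^ 2 := by
    have hdiv : x / p ^ (L * k + r + 1) = x / (p ^ L : ℕ) ^ (k + 1) * p ^ (L - (r + 1)) := by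
      have hexp : L * (k + 1) = L * k + r + 1 + (L - (r + 1)) := by
        rw [mul_add_one]
        have := Finset.mem_range.1 hr
        omega
      rw [Nat.cast_pow, ← pow_mul, hexp, pow_add _ (L * k + r + 1)]
      field
    rw [hdiv, ← mul_pow]
    gcongr
    exact norm_coe_mul_pow_le hp _ (Nat.sub_le _ _)
  induction K with
  | zero => simp [digitEnergy]
  | succ K ih =>
    simp only [digitEnergy] at ih ⊢
    rw [mul_add_one, Finset.sum_range_add, Finset.sum_range_succ, mul_add]
    gcongr
    refine (Finset.sum_le_card_nsmul _ _ _ (hterm K)).trans_eq ?_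
    rw [Finset.card_range, nsmul_eq_mul, mul_assoc]

end DigitEnergy

section DigitComplexity

/-- The positions `i` such that the digits number `i` and `i + 1` of `m` in base `p` are neither
both `0` nor both `p - 1`. -/
def mixedPositions (p m : ℕ) : Finset ℕ :=
  (Finset.range (p.digits m).length).filter fun i =>
    ¬ ((p.digits m).getD i 0 = 0 ∧ (p.digits m).getD (i + 1) 0 = 0) ∧
    ¬ ((p.digits m).getD i 0 = p - 1 ∧ (p.digits m).getD (i + 1) 0 = p - 1)

theorem countP_eq_card_filter {α : Type*} (w : List α) (f : α → Bool) (a : α) :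
    w.countP f = ((Finset.range w.length).filter fun i => f (w.getD i a)).card := by
  induction w using List.reverseRecOn with
  | nil => simp
  | append_singleton w x ih =>
    have hinit : ((Finset.range w.length).filter fun i => f ((w ++ [x]).getD i a)) =
        (Finset.range w.length).filter fun i => f (w.getD i a) :=
      Finset.filter_congr fun i hi => by rw [List.getD_append _ _ _ _ (Finset.mem_range.1 hi)]
    rw [List.countP_append, List.length_append, List.length_singleton, Finset.range_add_one,
      Finset.filter_insert, hinit, List.getD_append_right _ _ _ _ le_rfl, ih]
    by_cases hx : f x <;> simp [hx]

theorem getD_digits_succ_ne {p m d i : ℕ} (hi : (p.digits m)[i]? = some d)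
    (hn : (p.digits m)[i + 1]? ≠ some d) : (p.digits m).getD (i + 1) 0 ≠ d := by
  rw [List.getD_eq_getElem?_getD]
  cases hsucc : (p.digits m)[i + 1]? with
  | some e => exact fun h => hn (by rw [hsucc, ← h, Option.getD_some])
  | none =>
    rintro rfl
    obtain ⟨hlt, hzero⟩ := List.getElem?_eq_some_iff.1 hi
    have hlast : i = (p.digits m).length - 1 := by
      have := List.getElem?_eq_none_iff.1 hsucc
      omega
    have hm : m ≠ 0 := by
      rintro rfl
      simp at hlt
    refine Nat.getLast_digit_ne_zero p hm ?_
    rw [List.getLast_eq_getElem]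
    simpa only [hlast, Option.getD_none] using hzero

variable {p : ℕ}

theorem numBlocks_digits_le (hp : 2 ≤ p) (m : ℕ) {d : ℕ} (hd : d = 0 ∨ d = p - 1) :
    numBlocks d (p.digits m) ≤ (mixedPositions p m).card := by
  refine Finset.card_le_card fun i hi => ?_
  obtain ⟨hi, hdigit, hsucc⟩ := Finset.mem_filter.1 hi
  have hne := getD_digits_succ_ne hdigit hsucc
  refine Finset.mem_filter.2 ⟨hi, ?_⟩
  rw [List.getD_eq_getElem?_getD, hdigit, Option.getD_some]
  rcases hd with rfl | rfl <;> omega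

theorem digitComplexity_le_card_mixedPositions (hp : 2 ≤ p) (m : ℕ) :
    digitComplexity p m ≤ 3 * (mixedPositions p m).card := by
  have hother : ((p.digits m).countP fun x => x ≠ 0 ∧ x ≠ p - 1) ≤ (mixedPositions p m).card := by
    rw [countP_eq_card_filter _ _ 0]
    refine Finset.card_le_card (Finset.monotone_filter_right _ fun i _ hi => ?_)
    rw [decide_eq_true_eq] at hi
    exact ⟨fun h => hi.1 h.1, fun h => hi.2 h.1⟩
  have hzero := numBlocks_digits_le hp m (.inl rfl)
  have hlast := numBlocks_digits_le hp m (.inr rfl)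
  unfold digitComplexity
  omega

theorem two_digits_bounds {a b : ℕ} (ha : a < p) (hb : b < p) (h_zero : ¬ (a = 0 ∧ b = 0))
    (h_last : ¬ (a = p - 1 ∧ b = p - 1)) : 1 ≤ a + p * b ∧ a + p * b + 2 ≤ p * p := by
  obtain ⟨c, rfl⟩ := Nat.exists_eq_add_of_lt hb
  constructor
  · rcases Nat.eq_zero_or_pos a with rfl | ha
    · have : 0 < (b + c + 1) * b := by
        have : b ≠ 0 := by omega
        positivity
      omega
    · omega
  · rcases Nat.eq_zero_or_pos c with rfl | hc
    · have : a + 1 < b + 0 + 1 := by omega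
      nlinarith
    · nlinarith

theorem inv_sq_le_norm_of_mem_mixedPositions (hp : 2 ≤ p) {m i : ℕ}
    (hi : i ∈ mixedPositions p m) :
    ((p : ℝ) ^ 2)⁻¹ ≤ ‖((m / p ^ (i + 2) : ℝ) : UnitAddCircle)‖ := by
  obtain ⟨-, h_zero, h_last⟩ := Finset.mem_filter.1 hi
  rw [Nat.getD_digits _ _ hp, Nat.getD_digits _ _ hp] at h_zero h_last
  obtain ⟨hlow, hhigh⟩ := two_digits_bounds (Nat.mod_lt _ (by omega)) (Nat.mod_lt _ (by omega))
    h_zero h_last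
  set e := m / p ^ i % p + p * (m / p ^ (i + 1) % p) with he
  have hmod : m % p ^ (i + 2) = m % p ^ i + p ^ i * e := by
    rw [Nat.mod_pow_succ, Nat.mod_pow_succ, he]
    ring
  have hrem : m % p ^ i < p ^ i := Nat.mod_lt _ (by positivity)
  have hpow : p ^ (i + 2) = p ^ i * (p * p) := by ring
  have hlow' : p ^ i ≤ m % p ^ (i + 2) :=
    hmod ▸ (Nat.le_mul_of_pos_right _ hlow).trans (Nat.le_add_left _ _)
  have hhigh' : p ^ i + m % p ^ (i + 2) ≤ p ^ (i + 2) := by nlinarith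
  have hmin : p ^ i ≤ min (m % p ^ (i + 2)) (p ^ (i + 2) - m % p ^ (i + 2)) :=
    le_min hlow' (by omega)
  rw [UnitAddCircle.norm_eq, ← Nat.cast_pow p (i + 2), abs_sub_round_div_natCast_eq, Nat.cast_pow]
  have hcast : (p : ℝ) ^ i ≤ (min (m % p ^ (i + 2)) (p ^ (i + 2) - m % p ^ (i + 2)) : ℕ) := by
    exact_mod_cast hmin
  rw [inv_eq_one_div, div_le_div_iff₀ (by positivity) (by positivity), pow_add, one_mul]
  exact mul_le_mul_of_nonneg_right hcast (sq_nonneg _)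

theorem digitComplexity_le_digitEnergy (hp : 2 ≤ p) (m : ℕ) :
    digitComplexity p m ≤ 3 * p ^ 4 * digitEnergy p m ((p.digits m).length + 1) := by
  have hcard : ((mixedPositions p m).card : ℝ) * ((p : ℝ) ^ 4)⁻¹ ≤
      digitEnergy p m ((p.digits m).length + 1) := by
    rw [digitEnergy, Finset.sum_range_succ', ← nsmul_eq_mul]
    refine le_add_of_le_of_nonneg ((Finset.card_nsmul_le_sum _ _ _ fun i hi => ?_).trans
      (Finset.sum_le_sum_of_subset_of_nonneg (Finset.filter_subset _ _)
        fun _ _ _ => sq_nonneg _)) (sq_nonneg _)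
    calc ((p : ℝ) ^ 4)⁻¹ = (((p : ℝ) ^ 2)⁻¹) ^ 2 := by ring
      _ ≤ _ := by
        gcongr
        exact inv_sq_le_norm_of_mem_mixedPositions hp hi
  calc (digitComplexity p m : ℝ) ≤ 3 * (mixedPositions p m).card := by
        exact_mod_cast digitComplexity_le_card_mixedPositions hp m
    _ = 3 * p ^ 4 * ((mixedPositions p m).card * ((p : ℝ) ^ 4)⁻¹) := by field
    _ ≤ _ := by gcongr

theorem exists_digitComplexity_le_digitEnergy (hp : 2 ≤ p) {L : ℕ} (hL : L ≠ 0) (a : ℕ) (m : ℤ) :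
    ∃ K, digitComplexity p m.natAbs ≤
      3 * p ^ 4 * (L * (p ^ L : ℕ) ^ 2) * digitEnergy (p ^ L) (m * p ^ a) K := by
  have hp0 : p ≠ 0 := by omega
  set J := (p.digits m.natAbs).length + 1
  refine ⟨a + J, (digitComplexity_le_digitEnergy hp _).trans ?_⟩
  rw [mul_assoc _ (L * _ : ℝ)]
  gcongr
  calc digitEnergy p m.natAbs J = digitEnergy p m J := by
        rw [Nat.cast_natAbs, Int.cast_abs, digitEnergy_abs]
    _ ≤ digitEnergy p (m * p ^ a) (a + J) := digitEnergy_le_digitEnergy_mul_pow hp0 _ _ _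
    _ ≤ digitEnergy p (m * p ^ a) (L * (a + J)) :=
      digitEnergy_mono _ _ (Nat.le_mul_of_pos_left _ (Nat.pos_of_ne_zero hL))
    _ ≤ _ := digitEnergy_mul_le hp0 _ _ _

end DigitComplexity

section IidDigits

variable {b : ℕ} (q : Measure (Fin b)) [IsProbabilityMeasure q]

theorem indepFun_head_tail {α : Type*} [MeasurableSpace α] (μ : Measure α)
    [IsProbabilityMeasure μ] :
    ProbabilityTheory.IndepFun (fun ω : ℕ → α => ω 0) (fun ω k => ω (k + 1))
      (Measure.infinitePi fun _ : ℕ => μ) := by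
  have hind := ProbabilityTheory.iIndepFun_infinitePi (P := fun _ : ℕ => μ) (X := fun _ => id)
    fun _ => measurable_id
  have htail : MeasurableSpace.comap (fun (ω : ℕ → α) k => ω (k + 1)) MeasurableSpace.pi ≤
      ⨆ k ∈ Set.Ioi 0, MeasurableSpace.comap (fun ω : ℕ → α => ω k) ‹_› := by
    rw [MeasurableSpace.pi, MeasurableSpace.comap_iSup]
    exact iSup_le fun k => MeasurableSpace.comap_comp.trans_le
      (le_iSup₂_of_le (k + 1) k.succ_pos le_rfl)
  refine ProbabilityTheory.indep_of_indep_of_le_right ?_ htail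
  simpa using ProbabilityTheory.indep_iSup_of_disjoint (fun k => (measurable_pi_apply k).comap_le)
    hind (S := {0}) (T := Set.Ioi 0) (by simp)

theorem measurePreserving_tail {α : Type*} [MeasurableSpace α] (μ : Measure α)
    [IsProbabilityMeasure μ] :
    MeasurePreserving (fun (ω : ℕ → α) k => ω (k + 1)) (Measure.infinitePi fun _ : ℕ => μ)
      (Measure.infinitePi fun _ : ℕ => μ) :=
  ⟨by fun_prop, Measure.map_infinitePi_infinitePi_of_inj (add_left_injective 1)⟩

theorem ofDigits_eq_head_add_tail (ω : ℕ → Fin b) :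
    Real.ofDigits ω = (b : ℝ)⁻¹ * ω 0 + (b : ℝ)⁻¹ * Real.ofDigits fun k => ω (k + 1) := by
  rw [Real.ofDigits_eq_sum_add_ofDigits ω 1]
  simp [Real.ofDigitsTerm, mul_comm]

/-- The characteristic function of a law on the digits `0, …, b - 1`, seen as real numbers. -/
def digitCharFun (q : Measure (Fin b)) (t : ℝ) : ℂ := charFun (q.map fun d : Fin b => (d : ℝ)) t

/-- The law of the real number `∑ₖ ωₖ / b ^ (k + 1)` whose base-`b` digits `ωₖ` are independent
with common law `q`. -/
def iidDigitLaw : Measure ℝ := (Measure.infinitePi fun _ : ℕ => q).map Real.ofDigits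

theorem measurable_ofDigits : Measurable (Real.ofDigits (b := b)) :=
  Real.continuous_ofDigits.measurable

instance : IsProbabilityMeasure (iidDigitLaw q) :=
  Measure.isProbabilityMeasure_map measurable_ofDigits.aemeasurable

instance : IsProbabilityMeasure (q.map fun d : Fin b => (d : ℝ)) :=
  Measure.isProbabilityMeasure_map .of_discrete

theorem measurable_head : Measurable fun ω : ℕ → Fin b => (ω 0 : ℝ) :=
  (Measurable.of_discrete (f := fun d : Fin b => (d : ℝ))).comp (measurable_pi_apply 0)

theorem charFun_map_head (t : ℝ) :
    charFun ((Measure.infinitePi fun _ : ℕ => q).map fun ω => (b : ℝ)⁻¹ * ω 0) t =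
      digitCharFun q (t / b) := by
  have hhead : (Measure.infinitePi fun _ : ℕ => q).map (fun ω => (ω 0 : ℝ)) =
      q.map fun d : Fin b => (d : ℝ) := by
    conv_rhs => rw [← Measure.infinitePi_map_eval (fun _ : ℕ => q) 0]
    exact (Measure.map_map (g := fun d : Fin b => (d : ℝ)) .of_discrete
      (measurable_pi_apply 0)).symm
  rw [charFun_map_mul_comp measurable_head.aemeasurable, hhead, digitCharFun, inv_mul_eq_div]

theorem charFun_iidDigitLaw (t : ℝ) :
    charFun (iidDigitLaw q) t = digitCharFun q (t / b) * charFun (iidDigitLaw q) (t / b) := by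
  have hind : ProbabilityTheory.IndepFun (fun ω : ℕ → Fin b => (b : ℝ)⁻¹ * ω 0)
      (fun ω => (b : ℝ)⁻¹ * Real.ofDigits fun k => ω (k + 1))
      (Measure.infinitePi fun _ : ℕ => q) :=
    (indepFun_head_tail q).comp (φ := fun d : Fin b => (b : ℝ)⁻¹ * d)
      (ψ := fun ω => (b : ℝ)⁻¹ * Real.ofDigits ω) .of_discrete (measurable_ofDigits.const_mul _)
  have hmeas : Measurable fun ω : ℕ → Fin b => Real.ofDigits fun k => ω (k + 1) :=
    measurable_ofDigits.comp (measurePreserving_tail q).measurable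
  have htail : (Measure.infinitePi fun _ : ℕ => q).map
      (fun ω => Real.ofDigits fun k => ω (k + 1)) = iidDigitLaw q :=
    (Measure.map_map measurable_ofDigits (measurePreserving_tail q).measurable).symm.trans
      (congrArg (Measure.map Real.ofDigits) (measurePreserving_tail q).map_eq)
  have hsum : iidDigitLaw q = (Measure.infinitePi fun _ : ℕ => q).map
      ((fun ω => (b : ℝ)⁻¹ * ω 0) + fun ω => (b : ℝ)⁻¹ * Real.ofDigits fun k => ω (k + 1)) :=
    congrArg (Measure.map · _) (funext ofDigits_eq_head_add_tail)
  conv_lhs => rw [hsum, hind.charFun_map_add_eq_mul (measurable_head.const_mul _).aemeasurable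
    (hmeas.const_mul _).aemeasurable, Pi.mul_apply, charFun_map_head,
    charFun_map_mul_comp hmeas.aemeasurable, htail, inv_mul_eq_div]

theorem norm_charFun_iidDigitLaw_le {κ : ℝ}
    (hq : ∀ x : ℝ, ‖digitCharFun q (2 * Real.pi * x)‖ ≤
      Real.exp (-(κ * ‖(x : UnitAddCircle)‖ ^ 2))) (x : ℝ) (K : ℕ) :
    ‖charFun (iidDigitLaw q) (2 * Real.pi * x)‖ ≤ Real.exp (-(κ * digitEnergy b x K)) := by
  induction K generalizing x with
  | zero => simpa [digitEnergy] using norm_charFun_le_one (μ := iidDigitLaw q) (2 * Real.pi * x)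
  | succ K ih =>
    have henergy : digitEnergy b x (K + 1) =
        digitEnergy b (x / b) K + ‖((x / b : ℝ) : UnitAddCircle)‖ ^ 2 := by
      simp only [digitEnergy, Finset.sum_range_succ', zero_add, pow_one, div_div, ← pow_succ']
    rw [charFun_iidDigitLaw, norm_mul, mul_div_assoc, henergy, mul_add, neg_add, add_comm,
      Real.exp_add]
    gcongr
    exacts [hq _, ih _]

theorem norm_charFun_iidDigitLaw_sub_le (t : ℝ) :
    ‖charFun (iidDigitLaw q) t - digitCharFun q (t / b)‖ ≤ |t| / b := by
  rw [← charFun_map_head, iidDigitLaw, div_eq_mul_inv]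
  refine norm_charFun_map_sub_le measurable_ofDigits (measurable_head.const_mul _) (fun ω => ?_) t
  rw [ofDigits_eq_head_add_tail, add_sub_cancel_left, abs_of_nonneg
    (mul_nonneg (by positivity) (Real.ofDigits_nonneg _))]
  exact mul_le_of_le_one_right (by positivity) (Real.ofDigits_le_one _)

theorem measurePreserving_timesMap_iidDigitLaw :
    MeasurePreserving (timesMap b) ((iidDigitLaw q).map (↑)) ((iidDigitLaw q).map (↑)) := by
  have hcoe : Measurable fun ω : ℕ → Fin b => (Real.ofDigits ω : UnitAddCircle) :=
    AddCircle.measurable_mk'.comp measurable_ofDigits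
  have hlaw : (iidDigitLaw q).map (↑) = (Measure.infinitePi fun _ : ℕ => q).map
      fun ω => (Real.ofDigits ω : UnitAddCircle) :=
    Measure.map_map AddCircle.measurable_mk' measurable_ofDigits
  have hsemiconj (ω : ℕ → Fin b) : timesMap b (Real.ofDigits ω : UnitAddCircle) =
      (Real.ofDigits fun k => ω (k + 1) : ℝ) := by
    have hb : (b : ℝ) ≠ 0 := Nat.cast_ne_zero.2 (Nat.ne_zero_of_lt (ω 0).isLt)
    rw [timesMap, ← AddCircle.coe_zsmul, ofDigits_eq_head_add_tail ω, ← mul_add, zsmul_eq_mul,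
      Int.cast_natCast, mul_inv_cancel_left₀ hb, AddCircle.coe_add,
      add_eq_right, AddCircle.coe_eq_zero_iff]
    exact ⟨ω 0, by simp⟩
  refine ⟨measurable_timesMap b, ?_⟩
  rw [hlaw, Measure.map_map (measurable_timesMap b) hcoe]
  nth_rw 2 [← (measurePreserving_tail q).map_eq]
  rw [Measure.map_map hcoe (measurePreserving_tail q).measurable]
  exact congrArg (Measure.map · _) (funext hsemiconj)

end IidDigits

section FirstDigit

variable {b : ℕ} [NeZero b]

theorem abs_sub_digits_zero_le {x : ℝ} (hx : x ∈ Set.Ico 0 1) :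
    |x - (b : ℝ)⁻¹ * Real.digits x b 0| ≤ (b : ℝ)⁻¹ := by
  have hlower := Real.le_sum_ofDigitsTerm_digits (b := b) hx 1
  have hupper := Real.sum_ofDigitsTerm_digits_le (b := b) hx 1
  simp only [Finset.range_one, Finset.sum_singleton, Real.ofDigitsTerm, zero_add, pow_one]
    at hlower hupper
  rw [mul_comm, abs_of_nonneg (sub_nonneg.2 hupper)]
  linarith

theorem measurable_digits (i : ℕ) : Measurable fun x : ℝ => Real.digits x b i :=
  Measurable.of_discrete.comp (Nat.measurable_floor.comp (measurable_id.mul_const _))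

theorem measurable_equivIco : Measurable fun x : UnitAddCircle => (AddCircle.equivIco 1 0 x : ℝ) :=
  measurable_subtype_coe.comp (AddCircle.measurableEquivIco 1 0).measurable

/-- The law of the first base-`b` digit of the representative in `[0, 1)` of a random point of the
circle. -/
def firstDigitLaw (b : ℕ) [NeZero b] (μ : Measure UnitAddCircle) : Measure (Fin b) :=
  μ.map fun x => Real.digits (AddCircle.equivIco 1 0 x) b 0

instance (μ : Measure UnitAddCircle) [IsProbabilityMeasure μ] :
    IsProbabilityMeasure (firstDigitLaw b μ) :=
  Measure.isProbabilityMeasure_map ((measurable_digits 0).comp measurable_equivIco).aemeasurable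

theorem norm_digitCharFun_firstDigitLaw_sub_le (μ : Measure UnitAddCircle) [IsProbabilityMeasure μ]
    (m : ℤ) : ‖digitCharFun (firstDigitLaw b μ) (2 * Real.pi * m / b) - fourierStieltjes μ m‖ ≤
      |2 * Real.pi * m| / b := by
  have hdigit : Measurable fun x : UnitAddCircle => Real.digits (AddCircle.equivIco 1 0 x) b 0 :=
    (measurable_digits 0).comp measurable_equivIco
  have hfirst : Measurable fun x : UnitAddCircle =>
      (Real.digits (AddCircle.equivIco 1 0 x) b 0 : ℝ) :=
    (Measurable.of_discrete (f := fun d : Fin b => (d : ℝ))).comp hdigit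
  have hlift : (μ.map fun x => (AddCircle.equivIco 1 0 x : ℝ)).map (↑) = μ := by
    rw [Measure.map_map AddCircle.measurable_mk' measurable_equivIco]
    exact (congrArg (Measure.map · μ) (funext fun _ => AddCircle.coe_equivIco)).trans Measure.map_id
  have hcoeff : fourierStieltjes μ m =
      charFun (μ.map fun x => (AddCircle.equivIco 1 0 x : ℝ)) (2 * Real.pi * m) := by
    rw [← fourierStieltjes_map_coe, hlift]
  have hmap : (firstDigitLaw b μ).map (fun d : Fin b => (d : ℝ)) =
      μ.map fun x => (Real.digits (AddCircle.equivIco 1 0 x) b 0 : ℝ) :=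
    Measure.map_map .of_discrete hdigit
  rw [hcoeff, digitCharFun, hmap, ← inv_mul_eq_div, ← charFun_map_mul_comp hfirst.aemeasurable,
    norm_sub_rev, div_eq_mul_inv]
  refine norm_charFun_map_sub_le measurable_equivIco (hfirst.const_mul _) (fun x => ?_) _
  exact abs_sub_digits_zero_le (by simpa using (AddCircle.equivIco 1 0 x).2)

end FirstDigit

section SmoothedDigits

theorem digitCharFun_apply {b : ℕ} (q : Measure (Fin b)) (t : ℝ) :
    digitCharFun q t = ∫ d : Fin b, Complex.exp (t * (d : ℝ) * Complex.I) ∂q := by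
  rw [digitCharFun, charFun_apply_real, integral_map Measurable.of_discrete.aemeasurable
    (by fun_prop)]

variable {b : ℕ} [NeZero b] (q : Measure (Fin b)) [IsProbabilityMeasure q]

/-- The mixture of the digit law `q`, with weight `n / (n + 2)`, and of the digits `0` and `1`, with
weight `1 / (n + 2)` each. -/
def smoothedDigitLaw (q : Measure (Fin b)) (n : ℕ) : Measure (Fin b) :=
  (n + 2 : ENNReal)⁻¹ • ((n : ENNReal) • q + Measure.dirac 0 + Measure.dirac 1)

instance (n : ℕ) : IsProbabilityMeasure (smoothedDigitLaw q n) where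
  measure_univ := by
    have htwo : (n : ENNReal) + 1 + 1 = n + 2 := by rw [add_assoc, one_add_one_eq_two]
    simp only [smoothedDigitLaw, Measure.smul_apply, Measure.add_apply, measure_univ, smul_eq_mul,
      mul_one, htwo]
    exact ENNReal.inv_mul_cancel (by simp) (by finiteness)

theorem digitCharFun_smoothedDigitLaw (hb : 1 < b) (n : ℕ) (t : ℝ) :
    digitCharFun (smoothedDigitLaw q n) t =
      (n * digitCharFun q t + (1 + Complex.exp (t * Complex.I))) / (n + 2) := by
  have hint (κ : Measure (Fin b)) [IsFiniteMeasure κ] :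
      Integrable (fun d : Fin b => Complex.exp (t * (d : ℝ) * Complex.I)) κ := .of_finite
  rw [digitCharFun_apply, digitCharFun_apply, smoothedDigitLaw, integral_smul_measure,
    integral_add_measure (((hint q).smul_measure (by finiteness)).add_measure (hint _)) (hint _),
    integral_add_measure ((hint q).smul_measure (by finiteness)) (hint _), integral_smul_measure]
  have hweight : (n + 2 : ENNReal).toReal = n + 2 := by simp [ENNReal.toReal_add]
  simp [hweight, Nat.mod_eq_of_lt hb, div_eq_inv_mul, mul_add, add_assoc]

theorem norm_digitCharFun_smoothedDigitLaw_sub_le (hb : 1 < b) (n : ℕ) (t : ℝ) :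
    ‖digitCharFun (smoothedDigitLaw q n) t - digitCharFun q t‖ ≤ 4 / (n + 2) := by
  have hn : ‖(n + 2 : ℂ)‖ = n + 2 := by exact_mod_cast Complex.norm_natCast (n + 2)
  have hdiff : digitCharFun (smoothedDigitLaw q n) t - digitCharFun q t =
      (1 + Complex.exp (t * Complex.I) - 2 * digitCharFun q t) / (n + 2) := by
    have hn0 : (n + 2 : ℂ) ≠ 0 := by exact_mod_cast (n + 1).succ_ne_zero
    rw [digitCharFun_smoothedDigitLaw q hb]
    field
  have hq : ‖digitCharFun q t‖ ≤ 1 := norm_charFun_le_one t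
  rw [hdiff, norm_div, hn]
  gcongr
  calc _ ≤ ‖(1 : ℂ)‖ + ‖Complex.exp (t * Complex.I)‖ + ‖2 * digitCharFun q t‖ :=
        (norm_sub_le _ _).trans (by gcongr; exact norm_add_le _ _)
    _ ≤ 4 := by
      rw [norm_one, Complex.norm_exp_ofReal_mul_I, norm_mul, Complex.norm_ofNat]
      linarith

theorem norm_digitCharFun_smoothedDigitLaw_le (hb : 1 < b) (n : ℕ) (x : ℝ) :
    ‖digitCharFun (smoothedDigitLaw q n) (2 * Real.pi * x)‖ ≤
      Real.exp (-(4 / (n + 2) * ‖(x : UnitAddCircle)‖ ^ 2)) := by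
  have hn : ‖(n + 2 : ℂ)‖ = n + 2 := by exact_mod_cast Complex.norm_natCast (n + 2)
  have hq : ‖n * digitCharFun q (2 * Real.pi * x)‖ ≤ n := by
    rw [norm_mul, Complex.norm_natCast]
    exact mul_le_of_le_one_right n.cast_nonneg (norm_charFun_le_one _)
  have hatoms : ‖1 + Complex.exp ((2 * Real.pi * x : ℝ) * Complex.I)‖ ≤
      2 - 4 * ‖(x : UnitAddCircle)‖ ^ 2 := by
    have hangle : ((2 * Real.pi * x : ℝ) : ℂ) = 2 * (x * Real.pi : ℝ) := by push_cast; ring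
    rw [hangle, norm_one_add_exp]
    linarith [abs_cos_mul_pi_le x]
  calc _ ≤ (n + (2 - 4 * ‖(x : UnitAddCircle)‖ ^ 2)) / (n + 2) := by
        rw [digitCharFun_smoothedDigitLaw q hb, norm_div, hn]
        gcongr
        exact norm_add_le_of_le hq hatoms
    _ = 1 - 4 / (n + 2) * ‖(x : UnitAddCircle)‖ ^ 2 := by field
    _ ≤ _ := Real.one_sub_le_exp_neg _

end SmoothedDigits

section DigitDecay

/-- The Fourier–Stieltjes coefficient at `m` tends to `0` as the digit complexity of `m` tends to
infinity. -/
def HasDigitDecay (p : ℕ) (μ : Measure UnitAddCircle) : Prop :=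
  Tendsto (fourierStieltjes μ) (comap (fun m : ℤ => digitComplexity p m.natAbs) atTop) (𝓝 0)

variable {p : ℕ}

theorem hasDigitDecay_of_norm_le_exp {μ : Measure UnitAddCircle} {a : ℝ} (ha : 0 < a)
    (h : ∀ m, ‖fourierStieltjes μ m‖ ≤ Real.exp (-(a * digitComplexity p m.natAbs))) :
    HasDigitDecay p μ :=
  squeeze_zero_norm h <| Real.tendsto_exp_neg_atTop_nhds_zero.comp <|
    (tendsto_natCast_atTop_atTop.comp tendsto_comap).const_mul_atTop ha

theorem HasDigitDecay.tendsto_push {μ : ProbabilityMeasure UnitAddCircle} (hμ : HasDigitDecay p μ)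
    {c : ℕ → ℤ} (hc : ∀ a : ℤ, a ≠ 0 →
      TendstoInftyAlongDensityOne fun n => digitComplexity p (a * c n).natAbs) :
    Tendsto (fun n => push (c n) μ) densityOne (𝓝 leb) := by
  refine tendsto_iff_forall_fourierStieltjes.2 fun m => ?_
  simp_rw [fourierStieltjes_push]
  rcases eq_or_ne m 0 with rfl | hm
  · simp only [zero_mul, fourierStieltjes_zero, tendsto_const_nhds]
  · rw [fourierStieltjes_leb hm]
    exact hμ.comp (tendsto_comap_iff.2 (hc m hm).tendsto)

end DigitDecay

section IndependentBlocks

variable {p L : ℕ}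

/-- The average over `i < L` of the images under `T_{p ^ i}` of the law, on the circle, of a random
point whose base-`p ^ L` digits are independent with common law `q`. -/
def blockMeasure (p L : ℕ) (q : Measure (Fin (p ^ L))) : Measure UnitAddCircle :=
  orbitAverage (timesMap p) L ((iidDigitLaw q).map (↑))

theorem measurePreserving_blockMeasure (p L : ℕ) (q : Measure (Fin (p ^ L)))
    [IsProbabilityMeasure q] :
    MeasurePreserving (timesMap p) (blockMeasure p L q) (blockMeasure p L q) :=
  measurePreserving_orbitAverage (measurable_timesMap p) <| by
    rw [iterate_timesMap]
    exact measurePreserving_timesMap_iidDigitLaw q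

instance (q : Measure (Fin (p ^ L))) [IsProbabilityMeasure q] :
    IsProbabilityMeasure ((iidDigitLaw q).map ((↑) : ℝ → UnitAddCircle)) :=
  Measure.isProbabilityMeasure_map AddCircle.measurable_mk'.aemeasurable

theorem isProbabilityMeasure_blockMeasure (hL : L ≠ 0) (q : Measure (Fin (p ^ L)))
    [IsProbabilityMeasure q] : IsProbabilityMeasure (blockMeasure p L q) :=
  isProbabilityMeasure_orbitAverage (measurable_timesMap p) hL _

theorem fourierStieltjes_blockMeasure (q : Measure (Fin (p ^ L))) [IsProbabilityMeasure q]
    (m : ℤ) : fourierStieltjes (blockMeasure p L q) m =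
      (L : ℝ)⁻¹ • ∑ i ∈ Finset.range L, charFun (iidDigitLaw q) (2 * Real.pi * (m * p ^ i)) := by
  rw [blockMeasure, fourierStieltjes_orbitAverage]
  simp_rw [fourierStieltjes_map_coe]
  push_cast
  rfl

theorem norm_inv_smul_sum_le {E : Type*} [SeminormedAddCommGroup E] [NormedSpace ℝ E] {n : ℕ}
    {f : ℕ → E} {C : ℝ} (hC : 0 ≤ C) (h : ∀ i ∈ Finset.range n, ‖f i‖ ≤ C) :
    ‖(n : ℝ)⁻¹ • ∑ i ∈ Finset.range n, f i‖ ≤ C := by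
  rw [norm_smul, norm_inv, RCLike.norm_natCast]
  refine (mul_le_mul_of_nonneg_left (norm_sum_le_of_le _ h) (by positivity)).trans ?_
  rw [Finset.sum_const, Finset.card_range, nsmul_eq_mul, ← mul_assoc]
  exact mul_le_of_le_one_left hC (inv_mul_le_one)

theorem hasDigitDecay_blockMeasure (hp : 2 ≤ p) (hL : L ≠ 0) (q : Measure (Fin (p ^ L)))
    [IsProbabilityMeasure q] {κ : ℝ} (hκ : 0 < κ)
    (hq : ∀ x : ℝ, ‖digitCharFun q (2 * Real.pi * x)‖ ≤
      Real.exp (-(κ * ‖(x : UnitAddCircle)‖ ^ 2))) :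
    HasDigitDecay p (blockMeasure p L q) := by
  set C : ℝ := 3 * p ^ 4 * (L * (p ^ L : ℕ) ^ 2)
  have hC : 0 < C := by positivity
  refine hasDigitDecay_of_norm_le_exp (div_pos hκ hC) fun m => ?_
  rw [fourierStieltjes_blockMeasure]
  refine norm_inv_smul_sum_le (Real.exp_nonneg _) fun i _ => ?_
  obtain ⟨K, hK⟩ := exists_digitComplexity_le_digitEnergy hp hL i m
  refine (norm_charFun_iidDigitLaw_le q hq _ K).trans (Real.exp_le_exp.2 (neg_le_neg ?_))
  rw [div_mul_eq_mul_div, div_le_iff₀ hC, mul_assoc, mul_comm _ C]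
  gcongr

theorem norm_fourierStieltjes_blockMeasure_sub_le (hp : 2 ≤ p) (hL : L ≠ 0)
    (q : Measure (Fin (p ^ L))) [IsProbabilityMeasure q] {μ : ProbabilityMeasure UnitAddCircle}
    (hμ : push (p : ℤ) μ = μ) (m : ℤ) {A δ : ℝ} (hA : 0 ≤ A)
    (h : ∀ k : ℤ, ‖charFun (iidDigitLaw q) (2 * Real.pi * k) - fourierStieltjes μ k‖ ≤
      δ + A * |(k : ℝ)| / (p ^ L : ℕ)) :
    ‖fourierStieltjes (blockMeasure p L q) m - fourierStieltjes μ m‖ ≤ δ + A * |(m : ℝ)| / L := by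
  have hL0 : (L : ℝ) ≠ 0 := Nat.cast_ne_zero.2 hL
  have hterm (i : ℕ) (_ : i ∈ Finset.range L) :
      ‖charFun (iidDigitLaw q) (2 * Real.pi * (m * p ^ i)) - fourierStieltjes μ m‖ ≤
        δ + A * |(m : ℝ)| * p ^ i / (p ^ L : ℕ) := by
    have hi := h (m * p ^ i)
    rw [fourierStieltjes_mul_pow hμ] at hi
    push_cast at hi ⊢
    rwa [abs_mul, abs_of_nonneg (by positivity : (0 : ℝ) ≤ p ^ i), ← mul_assoc A] at hi
  have hgeom : ∑ i ∈ Finset.range L, (p : ℝ) ^ i ≤ (p ^ L : ℕ) := by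
    exact_mod_cast (Nat.geomSum_lt hp fun _ => Finset.mem_range.1).le
  have hmean : fourierStieltjes μ m = (L : ℝ)⁻¹ • ∑ _i ∈ Finset.range L, fourierStieltjes μ m := by
    rw [Finset.sum_const, Finset.card_range, ← Nat.cast_smul_eq_nsmul ℝ, inv_smul_smul₀ hL0]
  rw [fourierStieltjes_blockMeasure, hmean, ← smul_sub, ← Finset.sum_sub_distrib, norm_smul,
    norm_inv, RCLike.norm_natCast]
  calc _ ≤ (L : ℝ)⁻¹ * ∑ i ∈ Finset.range L, (δ + A * |(m : ℝ)| * p ^ i / (p ^ L : ℕ)) := by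
        gcongr
        exact norm_sum_le_of_le _ hterm
    _ = δ + A * |(m : ℝ)| / L * ((∑ i ∈ Finset.range L, (p : ℝ) ^ i) / (p ^ L : ℕ)) := by
        rw [Finset.sum_add_distrib, Finset.sum_const, Finset.card_range, nsmul_eq_mul,
          ← Finset.sum_div, ← Finset.mul_sum]
        field
    _ ≤ δ + A * |(m : ℝ)| / L := by
        gcongr
        exact mul_le_of_le_one_right (by positivity) (div_le_one_of_le₀ hgeom (by positivity))

theorem norm_charFun_iidDigitLaw_smoothed_sub_le {b : ℕ} [NeZero b] (hb : 1 < b)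
    (μ : Measure UnitAddCircle) [IsProbabilityMeasure μ] (n : ℕ) (k : ℤ) :
    ‖charFun (iidDigitLaw (smoothedDigitLaw (firstDigitLaw b μ) n)) (2 * Real.pi * k) -
      fourierStieltjes μ k‖ ≤ 4 / (n + 2) + 4 * Real.pi * |(k : ℝ)| / b := by
  have habs : |2 * Real.pi * k| = 2 * Real.pi * |(k : ℝ)| := by
    rw [abs_mul, abs_of_pos Real.two_pi_pos]
  have hiid := norm_charFun_iidDigitLaw_sub_le (smoothedDigitLaw (firstDigitLaw b μ) n)
    (2 * Real.pi * k)
  have hsmooth := norm_digitCharFun_smoothedDigitLaw_sub_le (firstDigitLaw b μ) hb n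
    (2 * Real.pi * k / b)
  have hfirst := norm_digitCharFun_firstDigitLaw_sub_le (b := b) μ k
  rw [habs] at hiid hfirst
  calc _ ≤ 2 * Real.pi * |(k : ℝ)| / b + 4 / (n + 2) + 2 * Real.pi * |(k : ℝ)| / b :=
        (norm_sub_le_norm_sub_add_norm_sub _ _ _).trans (add_le_add
          ((norm_sub_le_norm_sub_add_norm_sub _ _ _).trans (add_le_add hiid hsmooth)) hfirst)
    _ = _ := by ring

end IndependentBlocks

theorem exists_hasDigitDecay_norm_sub_le {p : ℕ} (hp : 2 ≤ p) (μ : InvMeasure p) (n : ℕ) :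
    ∃ ν : InvMeasure p, HasDigitDecay p ν.1 ∧ ∀ m : ℤ,
      ‖fourierStieltjes ν.1 m - fourierStieltjes μ.1 m‖ ≤
        4 / (n + 2) + 4 * Real.pi * |(m : ℝ)| / (n + 1 : ℕ) := by
  have hb : 1 < p ^ (n + 1) := Nat.one_lt_pow n.succ_ne_zero hp
  have : NeZero (p ^ (n + 1)) := ⟨by omega⟩
  set q := smoothedDigitLaw (firstDigitLaw (p ^ (n + 1)) μ.1) n
  have := isProbabilityMeasure_blockMeasure n.succ_ne_zero q
  let ν : ProbabilityMeasure UnitAddCircle := ⟨blockMeasure p (n + 1) q, this⟩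
  have hν : push (p : ℤ) ν = ν := Subtype.ext (measurePreserving_blockMeasure p (n + 1) q).map_eq
  refine ⟨⟨ν, hν⟩, ?_, fun m => ?_⟩
  · exact hasDigitDecay_blockMeasure hp n.succ_ne_zero q (by positivity)
      (norm_digitCharFun_smoothedDigitLaw_le _ hb n)
  · exact norm_fourierStieltjes_blockMeasure_sub_le hp n.succ_ne_zero q μ.2 m (by positivity)
      (norm_charFun_iidDigitLaw_smoothed_sub_le hb _ n)

theorem dense_setOf_hasDigitDecay {p : ℕ} (hp : 2 ≤ p) :
    Dense {μ : InvMeasure p | HasDigitDecay p μ.1} := fun μ => by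
  choose ν hdecay hclose using exists_hasDigitDecay_norm_sub_le hp μ
  refine mem_closure_of_tendsto (f := ν) (b := atTop) ?_ (.of_forall hdecay)
  refine tendsto_subtype_rng.2 (tendsto_iff_forall_fourierStieltjes.2 fun m => ?_)
  refine tendsto_iff_norm_sub_tendsto_zero.2
    (squeeze_zero (fun _ => norm_nonneg _) (fun n => hclose n m) ?_)
  have hn (k : ℕ) : Tendsto (fun n : ℕ => (n : ℝ) + k) atTop atTop :=
    tendsto_atTop_add_const_right _ _ tendsto_natCast_atTop_atTop
  simpa using ((hn 2).const_div_atTop 4).add ((hn 1).const_div_atTop _)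

end TimesP

end

theorem proposition5p12 (p : ℕ) (hp : 2 ≤ p) (c : ℕ → ℤ)
    (hc : ∀ a : ℤ, a ≠ 0 →
      TimesP.TendstoInftyAlongDensityOne
        fun n => TimesP.digitComplexity p (a * c n).natAbs) :
    TimesP.goodMeasures p c ∈ residual (TimesP.InvMeasure p) := by
  have hpush (n : ℕ) : Continuous fun μ : TimesP.InvMeasure p => TimesP.push (c n) μ.1 :=
    (ProbabilityMeasure.continuous_map (continuous_zsmul (c n))).comp continuous_subtype_val
  have hGδ : IsGδ {μ : TimesP.InvMeasure p |
      TimesP.TendstoAlongUpperDensityOne (fun n => TimesP.push (c n) μ.1) TimesP.leb} :=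
    TimesP.isGδ_setOf_tendstoAlongUpperDensityOne hpush TimesP.leb
  have hdense : Dense {μ : TimesP.InvMeasure p |
      TimesP.TendstoAlongUpperDensityOne (fun n => TimesP.push (c n) μ.1) TimesP.leb} :=
    (TimesP.dense_setOf_hasDigitDecay hp).mono fun μ hμ =>
      TimesP.tendstoAlongUpperDensityOne_of_tendsto (hμ.tendsto_push hc)
  exact mem_of_superset (residual_of_dense_Gδ hGδ hdense) fun μ hμ =>
    ⟨TimesP.singleton_eq_zero_of_tendstoAlongUpperDensityOne hμ, hμ⟩
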